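/- Let $c \ge 1$ be an integer and let $S$ be a finite set with a map $f : S \to \{1,\dots,c\}$ (the charge). Let $\mathrm{Inj}^c_\circ(S)$ be the simplicial complex whose vertices are the non-empty subsets $I \subset S$ with $\sum_{i \in I} f(i) \le c$, and in which distinct vertices $I_0,\dots,I_p$ span a $p$-simplex if and only if $I_j \cap I_k = \emptyset$ for all $j \ne k$. Then $\mathrm{Inj}^c_\circ(S)$ is weakly Cohen–Macaulay of dimension $\ge n$, where $n = \lfloor \#S/c \rfloor - 1$. That is, the geometric realization $|\mathrm{Inj}^c_\circ(S)|$ is $(n-1)$-connected, and for every $p \ge 0$ and every $p$-simplex $\sigma$ of $\mathrm{Inj}^c_\circ(S)$, the geometric realization of the link of $\sigma$ (the subcomplex of all simplices $\tau$ disjoint from $\sigma$, as sets of vertices, such that $\sigma \cup \tau$ is a simplex) is $(n-p-2)$-connected. Here every space is $k$-connected for $k \le -2$, a space is $(-1)$-connected if and only if it is non-empty, and for $k \ge 0$ a space $X$ is $k$-connected if it is non-empty, path-connected, and $\pi_i(X,x_0)$ is trivial for all $1 \le i \le k$ and all basepoints $x_0 \in X$. -/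

import Mathlib

/-- A space `X` is `k`-connected (`k` an integer): no condition for `k ≤ -2`; for `k ≥ -1` it is
nonempty; and `π_i(X, x)` is trivial for all basepoints `x` and all `0 ≤ i ≤ k`
(where `π_0(X, x)` is the set of path components). -/
def IsKConnected (k : ℤ) (X : Type*) [TopologicalSpace X] : Prop :=
  (-1 ≤ k → Nonempty X) ∧
    ∀ i : ℕ, (i : ℤ) ≤ k → ∀ x : X, Subsingleton (HomotopyGroup.Pi i X x)

namespace PreAbstractSimplicialComplex

/-- The geometric realization of a simplicial complex whose vertices lie in a finite type `V`:
the points of the standard simplex on `V` (in `V → ℝ`, with the Euclidean topology) whose support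
is contained in a face. -/
def realization {V : Type*} [Fintype V] (K : PreAbstractSimplicialComplex V) : Set (V → ℝ) :=
  {x | x ∈ stdSimplex ℝ V ∧ ∃ σ ∈ K.faces, ∀ v, x v ≠ 0 → v ∈ σ}

/-- The link of `σ` in `K`: the simplices `τ` disjoint from `σ` such that `σ ∪ τ` is a simplex. -/
def link {V : Type*} [DecidableEq V] (K : PreAbstractSimplicialComplex V) (σ : Finset V) :
    PreAbstractSimplicialComplex V where
  faces := {τ | τ.Nonempty ∧ Disjoint σ τ ∧ σ ∪ τ ∈ K.faces}
  isRelLowerSet_faces := by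
    rintro τ ⟨hne, hd, hK⟩
    refine ⟨hne, fun ρ hρ hρne => ⟨hρne, hd.mono_right hρ, ?_⟩⟩
    exact (K.isRelLowerSet_faces hK).2 (Finset.union_subset_union_right hρ)
      (hρne.mono Finset.subset_union_right)

/-- `K` is weakly Cohen–Macaulay of dimension `≥ n`: its realization is `(n - 1)`-connected, and
the link of each `p`-simplex is `(n - p - 2)`-connected. -/
def IsWeaklyCohenMacaulay {V : Type*} [Fintype V] [DecidableEq V]
    (K : PreAbstractSimplicialComplex V) (n : ℤ) : Prop :=
  IsKConnected (n - 1) K.realization ∧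
    ∀ (p : ℕ) (σ : Finset V), σ ∈ K.faces → σ.card = p + 1 →
      IsKConnected (n - p - 2) (K.link σ).realization

end PreAbstractSimplicialComplex

/-- The complex `Inj^c(S)` of a set `S` with charges `f`: its vertices are the nonempty finite
subsets `I` of `S` with `∑ i ∈ I, f i ≤ c`, and its simplices are the nonempty finite sets of
vertices that are pairwise disjoint as subsets of `S`. -/
def boundedChargeInj {S : Type*} (c : ℕ) (f : S → ℕ) :
    PreAbstractSimplicialComplex (Finset S) where
  faces := {σ | σ.Nonempty ∧ (∀ I ∈ σ, I.Nonempty ∧ ∑ i ∈ I, f i ≤ c) ∧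
    ∀ I ∈ σ, ∀ J ∈ σ, I ≠ J → Disjoint I J}
  isRelLowerSet_faces := by
    rintro σ ⟨hne, hv, hd⟩
    exact ⟨hne, fun τ hτ hτne => ⟨hτne, fun I hI => hv I (hτ hI),
      fun I hI J hJ => hd I (hτ hI) J (hτ hJ)⟩⟩

/-! Connectivity is replaced by an extension property: `X` is a `d`-extensor if maps into `X` from
closed subsets of compact sets in `ℝ^d` extend. Being a `d`-extensor for all `d ≤ k + 1` gives
`k`-connectedness (`isKConnected_of_isCompactExtensor`).

The charge matters only in that singletons are admissible and admissible sets have at most `c`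
elements. The induction needs a class closed under deleting vertices and taking links, hence
`disjointFamilies`. If some `I` in the family is not a singleton, the complex is the deletion of `I`
with a cone attached over the link of `I`. The deletion still has all singletons of `U`; the link is
a complex of the same kind on `U \ I`, which loses at most `c` points and so costs one dimension. If
only singletons remain, the complex is a full simplex, hence a cone.

The gluing step is `isCompactExtensor_of_deletion_of_link`. A hypersurface made of pieces of
coordinate hyperplanes separates where the map is near the vertex from where it avoids it. The map
is extended over the hypersurface into the link, then on either side into the star or the deletion.
-/

/-! ### Extension of maps from closed subsets of Euclidean space. -/

open Set in
/-- Two maps that are continuous on closed sets and agree on the intersection glue. -/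
theorem exists_continuousOn_union {T E : Type*} [TopologicalSpace T] [TopologicalSpace E]
    {A B : Set T} (hA : IsClosed A) (hB : IsClosed B) {f g : T → E} (hf : ContinuousOn f A)
    (hg : ContinuousOn g B) (hfg : ∀ x ∈ A, x ∈ B → f x = g x) :
    ∃ h : T → E, ContinuousOn h (A ∪ B) ∧ EqOn h f A ∧ EqOn h g B := by
  classical
  have h1 : EqOn (A.piecewise f g) f A := piecewise_eqOn _ _ _
  have h2 : EqOn (A.piecewise f g) g B := by
    intro x hx
    by_cases hxA : x ∈ A
    · rw [piecewise_eq_of_mem _ _ _ hxA, hfg x hxA hx]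
    · rw [piecewise_eq_of_notMem _ _ _ hxA]
  exact ⟨A.piecewise f g, (hf.congr h1).union_of_isClosed (hg.congr h2) hA hB, h1, h2⟩

/-- `X` is an extensor for compact subsets of `ℝ^d`: continuous maps to `X` from a closed subset
of such a compact set extend. -/
def IsCompactExtensor (d : ℕ) {E : Type*} [TopologicalSpace E] (X : Set E) : Prop :=
  ∀ Z A : Set (Fin d → ℝ), IsCompact Z → IsClosed A → A ⊆ Z →
    ∀ f : (Fin d → ℝ) → E, ContinuousOn f A → Set.MapsTo f A X →
      ∃ g : (Fin d → ℝ) → E, ContinuousOn g Z ∧ Set.MapsTo g Z X ∧ Set.EqOn g f A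

/-- `X` is a retract of one of its open neighborhoods. -/
def IsNeighborhoodRetract {E : Type*} [TopologicalSpace E] (X : Set E) : Prop :=
  ∃ (U : Set E) (r : E → E), IsOpen U ∧ X ⊆ U ∧ ContinuousOn r U ∧ Set.MapsTo r U X ∧
    Set.EqOn r id X

open Set in
theorem exists_continuous_eqOn {T V : Type*} [TopologicalSpace T] [NormalSpace T] {A : Set T}
    (hA : IsClosed A) {f : T → V → ℝ} (hf : ContinuousOn f A) :
    ∃ g : T → V → ℝ, Continuous g ∧ EqOn g f A := by
  have h : ∀ v, ∃ g : C(T, ℝ), g.restrict A = ⟨A.domRestrict fun x => f x v,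
      continuousOn_iff_continuous_domRestrict.1 (continuousOn_pi.1 hf v)⟩ :=
    fun v => ContinuousMap.exists_restrict_eq hA _
  choose g hg using h
  refine ⟨fun x v => g v x, by fun_prop, fun x hx => funext fun v => ?_⟩
  exact DFunLike.congr_fun (hg v) ⟨x, hx⟩

open Set in
/-- Borsuk's homotopy extension for straight-line homotopies into a neighborhood retract. -/
theorem IsNeighborhoodRetract.exists_extension {T V : Type*} [TopologicalSpace T] [NormalSpace T]
    {Y : Set (V → ℝ)} (hY : IsNeighborhoodRetract Y) {Z A : Set T}
    (hZ : IsClosed Z) (hA : IsClosed A) (hAZ : A ⊆ Z) {F f : T → V → ℝ}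
    (hF : ContinuousOn F Z) (hFY : MapsTo F Z Y) (hf : ContinuousOn f A)
    (hFf : ∀ x ∈ A, ∀ t ∈ Icc (0 : ℝ) 1, (1 - t) • F x + t • f x ∈ Y) :
    ∃ g : T → V → ℝ, ContinuousOn g Z ∧ MapsTo g Z Y ∧ EqOn g f A := by
  obtain ⟨U, r, hU, hYU, hr, hrY, hrid⟩ := hY
  obtain ⟨F', hF', hFF'⟩ := exists_continuous_eqOn hZ hF
  obtain ⟨f', hf', hff'⟩ := exists_continuous_eqOn hA hf
  let Φ : T × ℝ → V → ℝ := fun p => (1 - p.2) • F' p.1 + p.2 • f' p.1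
  have hΦ : Continuous Φ := by fun_prop
  -- The homotopy is run only up to time `u x`, with a Urysohn function `u` equal to `1` on `A` and
  -- `0` off `W`, so it never leaves `U` over `Z`.
  let W : Set T := {x | ∀ t ∈ Icc (0 : ℝ) 1, Φ (x, t) ∈ U}
  have hW : IsOpen W := by
    rw [isOpen_iff_eventually]
    intro x hx
    refine isCompact_Icc.eventually_forall_of_forall_eventually fun t ht => ?_
    exact (hΦ.continuousAt (x := (x, t))).eventually (hU.mem_nhds (hx t ht))
  have hAW : A ⊆ W := by
    intro x hx t ht
    have : Φ (x, t) = (1 - t) • F x + t • f x := by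
      simp only [Φ, hFF' (hAZ hx), hff' hx]
    rw [this]
    exact hYU (hFf x hx t ht)
  obtain ⟨u, hu0, hu1, hu⟩ := exists_continuous_zero_one_of_isClosed hW.isClosed_compl hA
    (disjoint_compl_left_iff_subset.2 hAW)
  have hmem : ∀ x ∈ Z, Φ (x, u x) ∈ U := by
    intro x hx
    by_cases hxW : x ∈ W
    · exact hxW _ (hu x)
    · have : u x = 0 := hu0 hxW
      simp only [Φ, this, hFF' hx, sub_zero, one_smul, zero_smul, add_zero]
      exact hYU (hFY hx)
  refine ⟨fun x => r (Φ (x, u x)), ?_, fun x hx => hrY (hmem x hx), fun x hx => ?_⟩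
  · exact hr.comp (by fun_prop) hmem
  · have h1 : u x = 1 := hu1 hx
    have h2 : Φ (x, u x) = f x := by simp [Φ, h1, hff' hx]
    have h3 : f x ∈ Y := by simpa using hFf x hx 1 (by simp)
    simp only [h2]
    exact hrid h3

-- On `A`, the constant map `p` is joined to `f` by segments inside `Y`, and the constant map
-- extends.
open Set in
theorem IsNeighborhoodRetract.isCompactExtensor {V : Type*} {Y : Set (V → ℝ)}
    (hY : IsNeighborhoodRetract Y) {p : V → ℝ} (hp : p ∈ Y) (hstar : StarConvex ℝ p Y) (d : ℕ) :
    IsCompactExtensor d Y := by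
  intro Z A hZ hA hAZ f hf hfY
  refine hY.exists_extension hZ.isClosed hA hAZ (F := fun _ => p) continuousOn_const
    (fun _ _ => hp) hf fun x hx t ht => ?_
  exact hstar (hfY hx) (by linarith [ht.2]) ht.1 (by ring)

open Set in
/-- Disjoint compact sets in a Euclidean space can be separated by finitely many coordinate
hyperplanes. -/
theorem exists_separation {d : ℕ} {A B : Set (Fin d → ℝ)} (hA : IsCompact A) (hB : IsClosed B)
    (hAB : Disjoint A B) : ∃ (P Q : Set (Fin d → ℝ)) (H : Finset (Fin d × ℝ)),
      IsClosed P ∧ IsClosed Q ∧ P ∪ Q = univ ∧ Disjoint A Q ∧ Disjoint B P ∧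
      ∀ x ∈ P, x ∈ Q → ∃ h ∈ H, x h.1 = h.2 := by
  classical
  have hr : ∀ x : Fin d → ℝ, ∃ r > 0, x ∈ A → Metric.closedBall x r ⊆ Bᶜ := by
    intro x
    by_cases hx : x ∈ A
    · obtain ⟨r, hr, h⟩ := Metric.nhds_basis_closedBall.mem_iff.1
        (hB.isOpen_compl.mem_nhds (disjoint_left.1 hAB hx))
      exact ⟨r, hr, fun _ => h⟩
    · exact ⟨1, one_pos, fun h => absurd h hx⟩
  choose r hr0 hrB using hr
  obtain ⟨t, htA, ht⟩ := hA.elim_nhds_subcover (fun x => Metric.ball x (r x))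
    (fun x _ => Metric.ball_mem_nhds x (hr0 x))
  -- Balls for the sup metric are cubes, so their spheres lie in the hyperplanes where the `j`-th
  -- coordinate is `x j ± r x`.
  refine ⟨⋃ x ∈ t, Metric.closedBall x (r x), (⋃ x ∈ t, Metric.ball x (r x))ᶜ,
    t.biUnion fun x => Finset.univ.biUnion fun j => {(j, x j + r x), (j, x j - r x)},
    ?_, ?_, ?_, ?_, ?_, ?_⟩
  · exact t.finite_toSet.isClosed_biUnion fun x _ => Metric.isClosed_closedBall
  · exact (isOpen_biUnion fun x _ => Metric.isOpen_ball).isClosed_compl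
  · rw [eq_univ_iff_forall]
    intro x
    by_cases hx : x ∈ ⋃ x ∈ t, Metric.ball x (r x)
    · exact Or.inl (iUnion₂_mono (fun x _ => Metric.ball_subset_closedBall) hx)
    · exact Or.inr hx
  · exact disjoint_compl_right_iff_subset.2 ht
  · rw [disjoint_left]
    intro x hx hxP
    obtain ⟨y, hy, hxy⟩ := mem_iUnion₂.1 hxP
    exact hrB y (htA y hy) hxy hx
  · intro x hxP hxQ
    obtain ⟨y, hy, hxy⟩ := mem_iUnion₂.1 hxP
    have hd : dist x y = r y := le_antisymm hxy (not_lt.1 fun h =>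
      hxQ (mem_iUnion₂.2 ⟨y, hy, h⟩))
    obtain ⟨j, hj⟩ := ((dist_pi_eq_iff (hr0 y)).1 hd).1
    rw [Real.dist_eq] at hj
    rcases abs_choice (x j - y j) with h | h
    · refine ⟨(j, y j + r y), ?_, by simp only; linarith⟩
      simp only [Finset.mem_biUnion]
      exact ⟨y, hy, j, Finset.mem_univ _, by simp⟩
    · refine ⟨(j, y j - r y), ?_, by simp only; linarith⟩
      simp only [Finset.mem_biUnion]
      exact ⟨y, hy, j, Finset.mem_univ _, by simp⟩

open Set in
/-- An extensor in dimension `d` is an extensor for compact subsets of `ℝ^(d+1)` that are contained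
in finitely many coordinate hyperplanes. -/
theorem IsCompactExtensor.exists_extension_hyperplanes {d : ℕ} {E : Type*} [TopologicalSpace E]
    {X : Set E} (hX : IsCompactExtensor d X) (H : Finset (Fin (d + 1) × ℝ)) :
    ∀ Z A : Set (Fin (d + 1) → ℝ), IsCompact Z → IsClosed A → A ⊆ Z →
      (∀ x ∈ Z, x ∉ A → ∃ h ∈ H, x h.1 = h.2) →
      ∀ f : (Fin (d + 1) → ℝ) → E, ContinuousOn f A → MapsTo f A X →
        ∃ g : (Fin (d + 1) → ℝ) → E, ContinuousOn g Z ∧ MapsTo g Z X ∧ EqOn g f A := by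
  classical
  induction H using Finset.induction_on with
  | empty =>
    intro Z A hZ hA hAZ hH f hf hfX
    have : A = Z := hAZ.antisymm fun x hx => by
      by_contra h
      simpa using hH x hx h
    subst this
    exact ⟨f, hf, hfX, fun _ _ => rfl⟩
  | insert h H hh ih =>
    intro Z A hZ hA hAZ hH f hf hfX
    obtain ⟨j, a⟩ := h
    let ι : (Fin d → ℝ) → Fin (d + 1) → ℝ := fun y => j.insertNth a y
    let π : (Fin (d + 1) → ℝ) → Fin d → ℝ := fun x => j.removeNth x
    have hι : Continuous ι := by fun_prop
    have hπ : Continuous π := by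
      unfold π Fin.removeNth; fun_prop
    have hπι : ∀ y, π (ι y) = y := fun y => by simp [π, ι]
    have hιπ : ∀ x, x j = a → ι (π x) = x := fun x hx => by
      simp only [π, ι, ← hx, Fin.insertNth_self_removeNth]
    have hιj : ∀ y, ι y j = a := fun y => by simp [ι]
    have hcl : IsClosed {x : Fin (d + 1) → ℝ | x j = a} :=
      isClosed_eq (by fun_prop) continuous_const
    have hpre : ι ⁻¹' Z = π '' (Z ∩ {x | x j = a}) := by
      ext y
      constructor
      · exact fun hy => ⟨ι y, ⟨hy, hιj y⟩, hπι y⟩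
      · rintro ⟨x, ⟨hx, hxa⟩, rfl⟩
        simpa [hιπ x hxa] using hx
    have hcomp : IsCompact (ι ⁻¹' Z) := by
      rw [hpre]
      exact (hZ.inter_right hcl).image hπ
    -- The slice of `Z` by one hyperplane is a compact set in `ℝ^d`; after extending over it, it
    -- joins `A` and the other hyperplanes remain.
    obtain ⟨g, hg, hgX, hgf⟩ := hX (ι ⁻¹' Z) (ι ⁻¹' A) hcomp (hA.preimage hι)
      (preimage_mono hAZ) (f ∘ ι) (hf.comp hι.continuousOn fun _ h => h) fun y hy => hfX hy
    have hmaps : MapsTo π (Z ∩ {x | x j = a}) (ι ⁻¹' Z) := fun x hx => by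
      rw [hpre]; exact ⟨x, hx, rfl⟩
    obtain ⟨k, hk, hkf, hkg⟩ := exists_continuousOn_union hA (hZ.isClosed.inter hcl) hf
      (hg.comp hπ.continuousOn hmaps) (by
        rintro x hxA ⟨-, hxj⟩
        have : ι (π x) = x := hιπ x hxj
        have h2 := hgf (x := π x) (by simpa [this] using hxA)
        simp [h2, this])
    obtain ⟨l, hl, hlX, hlk⟩ := ih Z (A ∪ Z ∩ {x | x j = a}) hZ (hA.union (hZ.isClosed.inter hcl))
      (union_subset hAZ inter_subset_left) (by
        intro x hx hxn
        obtain ⟨h, hhH, hxh⟩ := hH x hx fun hxA => hxn (Or.inl hxA)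
        rcases Finset.mem_insert.1 hhH with rfl | hhH
        · exact absurd (Or.inr ⟨hx, hxh⟩) hxn
        · exact ⟨h, hhH, hxh⟩) k hk (by
        rintro x (hx | hx)
        · rw [hkf hx]; exact hfX hx
        · rw [hkg hx]; exact hgX (hmaps hx))
    exact ⟨l, hl, hlX, fun x hx => (hlk (Or.inl hx)).trans (hkf hx)⟩

/-! ### From extensors to connectivity. -/

-- Dimension `0` with `A = ∅` yields a point. For `π_i`, a null-homotopy is an extension to the cube
-- in `ℝ^(i+1)` of the map that is the loop on the face `z 0 = 0` and constant on all other faces.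
open Set unitInterval in
theorem isKConnected_of_isCompactExtensor {V : Type*} {X : Set (V → ℝ)} {k : ℤ}
    (hX : ∀ d : ℕ, (d : ℤ) ≤ k + 1 → IsCompactExtensor d X) : IsKConnected k X := by
  constructor
  · intro hk
    obtain ⟨g, -, hg, -⟩ := hX 0 (by simpa using by linarith) univ ∅ isCompact_univ
      isClosed_empty (empty_subset _) (fun _ _ => 0) (continuousOn_empty _) (mapsTo_empty _ _)
    exact ⟨⟨g 0, hg (mem_univ _)⟩⟩
  · intro i hi x
    suffices h : ∀ f : GenLoop (Fin i) X x, GenLoop.Homotopic f GenLoop.const by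
      refine ⟨fun a b => ?_⟩
      induction a using Quotient.inductionOn with | _ a
      induction b using Quotient.inductionOn with | _ b
      exact Quotient.sound ((h a).trans (h b).symm)
    intro f
    let p : (Fin (i + 1) → ℝ) → Fin i → I := fun z j => projIcc 0 1 zero_le_one (z j.succ)
    have hp : Continuous p := by unfold p; fun_prop
    let Z : Set (Fin (i + 1) → ℝ) := Icc 0 1
    let A₀ : Set (Fin (i + 1) → ℝ) := Z ∩ {z | z 0 = 0}
    let A₁ : Set (Fin (i + 1) → ℝ) :=
      Z ∩ ({z | z 0 = 1} ∪ ⋃ j : Fin i, ({z | z j.succ = 0} ∪ {z | z j.succ = 1}))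
    have hZc : IsCompact Z := isCompact_Icc
    have hcl : ∀ (j : Fin (i + 1)) (a : ℝ), IsClosed {z : Fin (i + 1) → ℝ | z j = a} :=
      fun j a => isClosed_eq (by fun_prop) continuous_const
    have hA₀ : IsClosed A₀ := hZc.isClosed.inter (hcl _ _)
    have hA₁ : IsClosed A₁ := hZc.isClosed.inter ((hcl _ _).union
      (isClosed_iUnion_of_finite fun j => (hcl _ _).union (hcl _ _)))
    obtain ⟨φ, hφ, hφ0, hφ1⟩ := exists_continuousOn_union hA₀ hA₁
      (f := fun z => (f (p z) : V → ℝ)) (g := fun _ => (x : V → ℝ))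
      (continuous_subtype_val.comp ((map_continuous f.1).comp hp)).continuousOn
      continuousOn_const (by
        rintro z ⟨-, hz0⟩ ⟨-, hz1 | hz1⟩
        · exact absurd (hz0.symm.trans hz1) zero_ne_one
        · obtain ⟨j, hj⟩ := mem_iUnion.1 hz1
          rw [show f (p z) = x from f.2 (p z) ⟨j, hj.imp (fun h => ?_) (fun h => ?_)⟩]
          · ext; simp [p, show z j.succ = 0 from h]
          · ext; simp [p, show z j.succ = 1 from h])
    obtain ⟨G, hG, hGX, hGφ⟩ := hX (i + 1) (by push_cast; linarith) Z (A₀ ∪ A₁) hZc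
      (hA₀.union hA₁) (union_subset inter_subset_left inter_subset_left) φ hφ (by
        rintro z (hz | hz)
        · rw [hφ0 hz]; exact Subtype.coe_prop _
        · rw [hφ1 hz]; exact x.2)
    let c : I × (Fin i → I) → Fin (i + 1) → ℝ :=
      fun q => Fin.cons (q.1 : ℝ) fun j => (q.2 j : ℝ)
    have hc : Continuous c := by unfold c; fun_prop
    have hcZ : ∀ q, c q ∈ Z := by
      intro q
      refine ⟨fun j => ?_, fun j => ?_⟩ <;> refine Fin.cases ?_ (fun j => ?_) j
      · exact q.1.2.1
      · exact (q.2 j).2.1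
      · exact q.1.2.2
      · exact (q.2 j).2.2
    have hpc : ∀ q, p (c q) = q.2 := fun q => by ext j; simp [p, c]
    have hG0 : ∀ y, G (c (0, y)) = f y := by
      intro y
      have h : c (0, y) ∈ A₀ := ⟨hcZ _, by simp [c]⟩
      rw [hGφ (Or.inl h), hφ0 h]
      exact congrArg (fun y => (f y : V → ℝ)) (hpc _)
    have hG1 : ∀ q, q.1 = 1 ∨ q.2 ∈ Cube.boundary (Fin i) → G (c q) = x := by
      intro q hq
      have h : c q ∈ A₁ := by
        refine ⟨hcZ _, hq.imp (fun h => by simp [c, h]) ?_⟩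
        rintro ⟨j, hj⟩
        refine mem_iUnion.2 ⟨j, hj.imp (fun h => ?_) (fun h => ?_)⟩ <;> simp [c, h]
      rw [hGφ (Or.inr h), hφ1 h]
    refine ⟨⟨⟨⟨fun q => ⟨G (c q), hGX (hcZ q)⟩, ?_⟩, ?_, ?_⟩, ?_⟩⟩
    · exact (hG.comp_continuous hc hcZ).subtype_mk _
    · exact fun y => Subtype.ext (hG0 y)
    · exact fun y => Subtype.ext (hG1 _ (Or.inl rfl))
    · intro t y hy
      refine Subtype.ext ((hG1 (t, y) (Or.inr hy)).trans ?_)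
      rw [f.2 y hy]

/-! ### Realizations, and attaching a cone over a link. -/

namespace PreAbstractSimplicialComplex

section collapse

variable {V : Type*} [DecidableEq V] {v : V} {x : V → ℝ}

/-- A self-map of the simplex that pushes the points with `v`-th coordinate at most `2 / 3` to the
face opposite to `v`. -/
noncomputable def collapse (v : V) (x : V → ℝ) : V → ℝ := fun w =>
  -- For `x v ≤ 2 / 3` the other coordinates are normalized to sum `1`; beyond that they are
  -- tripled, and `3 * (1 - x v) + (3 * x v - 2) = 1`.
  if w = v then max 0 (3 * x v - 2) else x w / max (1 / 3) (1 - x v)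

theorem continuous_collapse (v : V) : Continuous (collapse v) := by
  refine continuous_pi fun w => ?_
  unfold collapse
  split_ifs
  · fun_prop
  · refine Continuous.div (by fun_prop) (by fun_prop) fun x => ?_
    exact (lt_max_of_lt_left (by norm_num : (0 : ℝ) < 1 / 3)).ne'

theorem collapse_apply_eq_zero {w : V} (hw : x w = 0) : collapse v x w = 0 := by
  unfold collapse
  split_ifs with h
  · subst h; norm_num [hw]
  · simp [hw]

theorem collapse_self_eq_zero (hx : x v ≤ 2 / 3) : collapse v x v = 0 := by
  rw [collapse, if_pos rfl, max_eq_left (by linarith)]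

end collapse

variable {V : Type*} [Fintype V]

open Classical in
theorem mem_realization_iff {K : PreAbstractSimplicialComplex V} {x : V → ℝ} :
    x ∈ K.realization ↔ x ∈ stdSimplex ℝ V ∧ (Finset.univ.filter fun v => x v ≠ 0) ∈ K.faces := by
  refine and_congr_right fun hx => ⟨?_, fun h => ⟨_, h, fun v hv => by simpa using hv⟩⟩
  rintro ⟨σ, hσ, h⟩
  refine (K.isRelLowerSet_faces hσ).2 (fun v hv => h v (by simpa using hv)) ?_
  by_contra hne
  rw [Finset.not_nonempty_iff_eq_empty, Finset.filter_eq_empty_iff] at hne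
  have h0 : ∀ v, x v = 0 := fun v => by simpa using hne (Finset.mem_univ v)
  simpa [h0] using hx.2

theorem realization_mono {K L : PreAbstractSimplicialComplex V} (h : K.faces ⊆ L.faces) :
    K.realization ⊆ L.realization := fun _ ⟨hx, σ, hσ, hs⟩ => ⟨hx, σ, h hσ, hs⟩

theorem segment_mem_realization {K : PreAbstractSimplicialComplex V} {σ : Finset V}
    (hσ : σ ∈ K.faces) {x y : V → ℝ} (hx : x ∈ stdSimplex ℝ V) (hy : y ∈ stdSimplex ℝ V)
    (hxσ : ∀ v, x v ≠ 0 → v ∈ σ) (hyσ : ∀ v, y v ≠ 0 → v ∈ σ) {a b : ℝ} (ha : 0 ≤ a)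
    (hb : 0 ≤ b) (hab : a + b = 1) : a • x + b • y ∈ K.realization := by
  refine ⟨convex_stdSimplex ℝ V hx hy ha hb hab, σ, hσ, fun v hv => ?_⟩
  by_contra h
  have h1 : x v = 0 := by_contra fun h' => h (hxσ v h')
  have h2 : y v = 0 := by_contra fun h' => h (hyσ v h')
  exact hv (by simp [h1, h2])

-- Subtract `m x`, truncate at `0` and normalize. If the new support were a non-face `T`, then all
-- `x v` with `v ∈ T` would exceed `m x`, while `m x` is at least their minimum.
open Classical in
theorem isNeighborhoodRetract_realization (K : PreAbstractSimplicialComplex V) :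
    IsNeighborhoodRetract K.realization := by
  let m : (V → ℝ) → ℝ := fun x =>
    ∑ T : {T : Finset V // T.Nonempty ∧ T ∉ K.faces}, max 0 (T.1.inf' T.2.1 fun v => x v)
  have hm : Continuous m := by
    refine continuous_finsetSum _ fun T _ => continuous_const.max ?_
    exact Continuous.finset_inf'_apply _ fun v _ => continuous_apply v
  let q : (V → ℝ) → V → ℝ := fun x v => max 0 (x v - m x)
  have hq : Continuous q := by fun_prop
  have hq0 : ∀ x v, 0 ≤ q x v := fun x v => le_max_left _ _
  have hqx : ∀ x ∈ K.realization, q x = x := by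
    rintro x ⟨hx, σ, hσ, hsupp⟩
    have h0 : m x = 0 := by
      refine Finset.sum_eq_zero fun T _ => max_eq_left ?_
      obtain ⟨v, hvT, hvσ⟩ : ∃ v ∈ T.1, v ∉ σ := by
        by_contra! h
        exact T.2.2 ((K.isRelLowerSet_faces hσ).2 h T.2.1)
      have : x v = 0 := by_contra fun h => hvσ (hsupp v h)
      exact (Finset.inf'_le _ hvT).trans this.le
    funext v
    simp [q, h0, hx.1 v]
  have hqK : ∀ x, 0 < ∑ v, q x v → (Finset.univ.filter fun v => q x v ≠ 0) ∈ K.faces := by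
    intro x hx
    by_contra hT
    have hne : (Finset.univ.filter fun v => q x v ≠ 0).Nonempty := by
      obtain ⟨v, -, hv⟩ := Finset.exists_ne_zero_of_sum_ne_zero hx.ne'
      exact ⟨v, by simpa using hv⟩
    have h1 : m x < (Finset.univ.filter fun v => q x v ≠ 0).inf' hne fun v => x v := by
      rw [Finset.lt_inf'_iff]
      intro v hv
      by_contra h
      exact (Finset.mem_filter.1 hv).2 (max_eq_left (by linarith))
    have h2 := Finset.single_le_sum
      (f := fun T : {T : Finset V // T.Nonempty ∧ T ∉ K.faces} =>
        max 0 (T.1.inf' T.2.1 fun v => x v)) (fun T _ => le_max_left _ _)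
      (Finset.mem_univ ⟨_, hne, hT⟩)
    exact absurd h1 (not_lt.2 ((le_max_right _ _).trans h2))
  refine ⟨{x | 0 < ∑ v, q x v}, fun x v => q x v / ∑ w, q x w, ?_, ?_, ?_, ?_, ?_⟩
  · exact isOpen_lt continuous_const (by fun_prop)
  · intro x hx
    simp [hqx x hx, hx.1.2]
  · refine continuousOn_pi.2 fun v => ContinuousOn.div ?_ ?_ fun x hx => (ne_of_gt hx)
    · fun_prop
    · fun_prop
  · intro x hx
    have hx : 0 < ∑ v, q x v := hx
    refine mem_realization_iff.2 ⟨⟨fun v => div_nonneg (hq0 x v) hx.le, ?_⟩, ?_⟩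
    · rw [← Finset.sum_div, div_self hx.ne']
    · simpa only [ne_eq, div_eq_zero_iff, hx.ne', or_false] using hqK x hx
  · intro x hx
    simp [hqx x hx, hx.1.2]

/-- A complex all of whose faces can be enlarged by a vertex `v` is a cone, so it is an extensor. -/
theorem isCompactExtensor_of_cone {K : PreAbstractSimplicialComplex V} [DecidableEq V] {v : V}
    (hv : {v} ∈ K.faces) (hK : ∀ σ ∈ K.faces, insert v σ ∈ K.faces) (d : ℕ) :
    IsCompactExtensor d K.realization := by
  have hs : ∀ w, (Pi.single v 1 : V → ℝ) w ≠ 0 → w = v := fun w hw => by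
    by_contra h
    exact hw (Pi.single_eq_of_ne h 1)
  refine K.isNeighborhoodRetract_realization.isCompactExtensor (p := Pi.single v 1)
    ⟨single_mem_stdSimplex ℝ v, {v}, hv, fun w hw => Finset.mem_singleton.2 (hs w hw)⟩ ?_ d
  rintro y ⟨hy, σ, hσ, hyσ⟩ a b ha hb hab
  exact segment_mem_realization (hK σ hσ) (single_mem_stdSimplex ℝ v) hy
    (fun w hw => Finset.mem_insert.2 (Or.inl (hs w hw)))
    (fun w hw => Finset.mem_insert_of_mem (hyσ w hw)) ha hb hab

/-- The faces that do not contain `v`. -/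
def deletion (K : PreAbstractSimplicialComplex V) (v : V) : PreAbstractSimplicialComplex V where
  faces := {τ | τ ∈ K.faces ∧ v ∉ τ}
  isRelLowerSet_faces := fun _ ⟨hτ, hv⟩ => ⟨(K.isRelLowerSet_faces hτ).1, fun _ hρ hne =>
    ⟨(K.isRelLowerSet_faces hτ).2 hρ hne, fun h => hv (hρ h)⟩⟩

/-- The faces that together with `v` span a face. -/
def closedStar [DecidableEq V] (K : PreAbstractSimplicialComplex V) (v : V) :
    PreAbstractSimplicialComplex V where
  faces := {τ | τ.Nonempty ∧ insert v τ ∈ K.faces}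
  isRelLowerSet_faces := fun _ ⟨hne, hτ⟩ => ⟨hne, fun _ hρ hne' =>
    ⟨hne', (K.isRelLowerSet_faces hτ).2 (Finset.insert_subset_insert v hρ)
      (Finset.insert_nonempty _ _)⟩⟩

section collapse

variable [DecidableEq V] {v : V} {x : V → ℝ}

theorem collapse_mem_stdSimplex (v : V) (hx : x ∈ stdSimplex ℝ V) :
    collapse v x ∈ stdSimplex ℝ V := by
  have hpos : (0 : ℝ) < max (1 / 3) (1 - x v) := lt_max_of_lt_left (by norm_num)
  constructor
  · intro w
    unfold collapse
    split_ifs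
    · exact le_max_left _ _
    · exact div_nonneg (hx.1 w) hpos.le
  · have h1 := Finset.add_sum_erase Finset.univ x (Finset.mem_univ v)
    rw [hx.2] at h1
    have h2 : ∑ w ∈ Finset.univ.erase v, collapse v x w =
        (1 - x v) / max (1 / 3) (1 - x v) := by
      rw [← eq_sub_iff_add_eq'.2 h1, Finset.sum_div, eq_sub_iff_add_eq'.2 h1]
      exact Finset.sum_congr rfl fun w hw => if_neg (Finset.ne_of_mem_erase hw)
    rw [← Finset.add_sum_erase _ _ (Finset.mem_univ v), h2, collapse, if_pos rfl]
    rcases le_total (x v) (2 / 3) with h | h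
    · rw [max_eq_left (by linarith), max_eq_right (by linarith), div_self (by linarith), zero_add]
    · rw [max_eq_right (by linarith), max_eq_left (by linarith)]
      ring

variable {K : PreAbstractSimplicialComplex V}

theorem collapse_mem_deletion (hx : x ∈ K.realization) (hv : x v ≤ 2 / 3) :
    collapse v x ∈ (K.deletion v).realization := by
  classical
  obtain ⟨hx, σ, hσ, hxσ⟩ := hx
  have h : collapse v x ∈ K.realization := ⟨collapse_mem_stdSimplex v hx, σ, hσ,
    fun w hw => hxσ w fun h => hw (collapse_apply_eq_zero h)⟩
  rw [mem_realization_iff] at h ⊢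
  exact ⟨h.1, h.2, by simp [collapse_self_eq_zero hv]⟩

theorem collapse_mem_closedStar (hx : x ∈ K.realization) (hv : 0 < x v) :
    collapse v x ∈ (K.closedStar v).realization := by
  obtain ⟨hx, σ, hσ, hxσ⟩ := hx
  refine ⟨collapse_mem_stdSimplex v hx, σ, ⟨(K.isRelLowerSet_faces hσ).1, ?_⟩,
    fun w hw => hxσ w fun h => hw (collapse_apply_eq_zero h)⟩
  rwa [Finset.insert_eq_of_mem (hxσ v hv.ne')]

theorem collapse_mem_link (hx : x ∈ K.realization) (hv : 0 < x v) (hv' : x v ≤ 2 / 3) :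
    collapse v x ∈ (K.link {v}).realization := by
  classical
  have h1 := mem_realization_iff.1 (collapse_mem_closedStar hx hv)
  have h2 := mem_realization_iff.1 (collapse_mem_deletion hx hv')
  exact mem_realization_iff.2 ⟨h1.1, h1.2.1, Finset.disjoint_singleton_left.2 h2.2.2, h1.2.2⟩

end collapse

open Set in
/-- The complex `K` arises from the deletion of a vertex by attaching a cone on its link. -/
theorem isCompactExtensor_of_deletion_of_link [DecidableEq V] {K : PreAbstractSimplicialComplex V}
    {v : V} (hv : {v} ∈ K.faces) {d : ℕ}
    (hdel : IsCompactExtensor (d + 1) (K.deletion v).realization)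
    (hlink : IsCompactExtensor d (K.link {v}).realization) :
    IsCompactExtensor (d + 1) K.realization := by
  have hstar : IsCompactExtensor (d + 1) (K.closedStar v).realization := by
    refine isCompactExtensor_of_cone (K := K.closedStar v) (v := v) ⟨Finset.singleton_nonempty v, by simpa using hv⟩
      (fun σ hσ => ⟨Finset.insert_nonempty _ _, by simpa using hσ.2⟩) _
  have hLD : (K.link {v}).realization ⊆ (K.deletion v).realization := realization_mono
    fun τ hτ => ⟨(K.isRelLowerSet_faces hτ.2.2).2 Finset.subset_union_right hτ.1,
      Finset.disjoint_singleton_left.1 hτ.2.1⟩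
  have hLS : (K.link {v}).realization ⊆ (K.closedStar v).realization := realization_mono
    fun τ hτ => ⟨hτ.1, hτ.2.2⟩
  have hDK : (K.deletion v).realization ⊆ K.realization := realization_mono fun τ hτ => hτ.1
  have hSK : (K.closedStar v).realization ⊆ K.realization := realization_mono
    fun τ hτ => (K.isRelLowerSet_faces hτ.2).2 (Finset.subset_insert _ _) hτ.1
  intro Z A hZ hA hAZ f hf hfK
  have hAc : IsCompact A := hZ.of_isClosed_subset hA hAZ
  have hfv : ContinuousOn (fun x => f x v) A := continuousOn_pi.1 hf v
  have hhigh : IsClosed (A ∩ {x | 2 / 3 ≤ f x v}) :=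
    hfv.preimage_isClosed_of_isClosed hA isClosed_Ici
  have hlow : IsClosed (A ∩ {x | f x v ≤ 0}) :=
    hfv.preimage_isClosed_of_isClosed hA isClosed_Iic
  obtain ⟨P, Q, H, hP, hQ, hPQ, hQhigh, hPlow, hH⟩ := exists_separation
    (hAc.of_isClosed_subset hhigh inter_subset_left) hlow (by
      rw [disjoint_left]
      rintro x ⟨-, h1⟩ ⟨-, h2⟩
      simp only [mem_ofPred_eq] at h1 h2
      linarith)
  have hfQ : ∀ x ∈ A, x ∈ Q → f x v ≤ 2 / 3 := fun x hxA hxQ =>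
    le_of_not_ge fun h => disjoint_left.1 hQhigh ⟨hxA, h⟩ hxQ
  have hfP : ∀ x ∈ A, x ∈ P → 0 < f x v := fun x hxA hxP =>
    lt_of_not_ge fun h => disjoint_left.1 hPlow ⟨hxA, h⟩ hxP
  let f' : (Fin (d + 1) → ℝ) → V → ℝ := fun x => collapse v (f x)
  have hf' : ContinuousOn f' A := (continuous_collapse v).comp_continuousOn hf
  have hR : IsClosed (Z ∩ (P ∩ Q)) := hZ.isClosed.inter (hP.inter hQ)
  -- On `A ∩ P ∩ Q` the collapsed map lands in the link; as `P ∩ Q` lies in hyperplanes, the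
  -- lower-dimensional extensor property suffices.
  obtain ⟨g, hg, hgL, hgf⟩ := hlink.exists_extension_hyperplanes H (Z ∩ (P ∩ Q)) (A ∩ (P ∩ Q))
    (hZ.inter_right (hP.inter hQ)) (hA.inter (hP.inter hQ)) (inter_subset_inter_left _ hAZ)
    (fun x hx _ => hH x hx.2.1 hx.2.2) f' (hf'.mono inter_subset_left)
    (fun x hx => collapse_mem_link (hfK hx.1) (hfP x hx.1 hx.2.1) (hfQ x hx.1 hx.2.2))
  have key : ∀ (N : Set (Fin (d + 1) → ℝ)) (X : Set (V → ℝ)), IsClosed N → P ∩ Q ⊆ N →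
      IsCompactExtensor (d + 1) X → (K.link {v}).realization ⊆ X →
      (∀ x ∈ A, x ∈ N → f' x ∈ X) →
      ∃ G : (Fin (d + 1) → ℝ) → V → ℝ, ContinuousOn G (Z ∩ N) ∧ MapsTo G (Z ∩ N) X ∧
        EqOn G f' (A ∩ N) ∧ EqOn G g (Z ∩ (P ∩ Q)) := by
    intro N X hN hPQN hX hLX hfX
    obtain ⟨k, hk, hkf, hkg⟩ := exists_continuousOn_union (hA.inter hN) hR
      (hf'.mono inter_subset_left) hg (fun x hxA hxR => (hgf ⟨hxA.1, hxR.2⟩).symm)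
    obtain ⟨G, hG, hGX, hGk⟩ := hX (Z ∩ N) (A ∩ N ∪ Z ∩ (P ∩ Q)) (hZ.inter_right hN)
      ((hA.inter hN).union hR) (union_subset (inter_subset_inter_left _ hAZ)
        (inter_subset_inter_right _ hPQN)) k hk (by
        rintro x (hx | hx)
        · rw [hkf hx]; exact hfX x hx.1 hx.2
        · rw [hkg hx]; exact hLX (hgL hx))
    exact ⟨G, hG, hGX, fun x hx => (hGk (Or.inl hx)).trans (hkf hx),
      fun x hx => (hGk (Or.inr hx)).trans (hkg hx)⟩
  obtain ⟨GP, hGP, hGPS, hGPf, hGPg⟩ := key P _ hP inter_subset_left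
    hstar hLS
    (fun x hxA hxP => collapse_mem_closedStar (hfK hxA) (hfP x hxA hxP))
  obtain ⟨GQ, hGQ, hGQD, hGQf, hGQg⟩ := key Q _ hQ inter_subset_right
    hdel hLD
    (fun x hxA hxQ => collapse_mem_deletion (hfK hxA) (hfQ x hxA hxQ))
  obtain ⟨F, hF, hFP, hFQ⟩ := exists_continuousOn_union (hZ.isClosed.inter hP)
    (hZ.isClosed.inter hQ) hGP hGQ (fun x hxP hxQ =>
      (hGPg ⟨hxP.1, hxP.2, hxQ.2⟩).trans (hGQg ⟨hxP.1, hxP.2, hxQ.2⟩).symm)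
  have hcases : ∀ x, x ∈ P ∨ x ∈ Q := fun x => by
    have : x ∈ P ∪ Q := hPQ ▸ mem_univ x
    exact this
  rw [← inter_union_distrib_left, hPQ, inter_univ] at hF
  -- `F` extends only the collapse of `f`. Collapsing does not enlarge supports, so segments from it
  -- to `f` stay in a face and homotopy extension applies.
  refine K.isNeighborhoodRetract_realization.exists_extension hZ.isClosed hA hAZ hF ?_ hf ?_
  · intro x hx
    rcases hcases x with h | h
    · rw [hFP ⟨hx, h⟩]; exact hSK (hGPS ⟨hx, h⟩)
    · rw [hFQ ⟨hx, h⟩]; exact hDK (hGQD ⟨hx, h⟩)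
  · intro x hx t ht
    have hFx : F x = collapse v (f x) := by
      rcases hcases x with h | h
      · rw [hFP ⟨hAZ hx, h⟩, hGPf ⟨hx, h⟩]
      · rw [hFQ ⟨hAZ hx, h⟩, hGQf ⟨hx, h⟩]
    obtain ⟨hfx, σ, hσ, hsupp⟩ := hfK hx
    rw [hFx]
    exact segment_mem_realization hσ (collapse_mem_stdSimplex v hfx) hfx
      (fun w hw => hsupp w fun h => hw (collapse_apply_eq_zero h)) hsupp
      (by linarith [ht.2]) ht.1 (by ring)

end PreAbstractSimplicialComplex

/-! ### Complexes of disjoint sets, and the induction. -/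

/-- The complex of the nonempty sets of pairwise disjoint members of a family of finite sets. -/
def disjointFamilies {S : Type*} (𝒱 : Finset (Finset S)) :
    PreAbstractSimplicialComplex (Finset S) where
  faces := {σ | σ.Nonempty ∧ σ ⊆ 𝒱 ∧ ∀ I ∈ σ, ∀ J ∈ σ, I ≠ J → Disjoint I J}
  isRelLowerSet_faces := fun _ ⟨hne, hv, hd⟩ => ⟨hne, fun _ hτ hτne => ⟨hτne, hτ.trans hv,
    fun I hI J hJ => hd I (hτ hI) J (hτ hJ)⟩⟩

section disjointFamilies

open PreAbstractSimplicialComplex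

variable {S : Type*} [DecidableEq S]

theorem deletion_disjointFamilies (𝒱 : Finset (Finset S)) (I : Finset S) :
    (disjointFamilies 𝒱).deletion I = disjointFamilies (𝒱.erase I) := by
  ext σ
  simp only [deletion, disjointFamilies, Set.mem_ofPred_eq, Finset.subset_erase]
  tauto

variable [Fintype S]

/-- Nonemptiness keeps the filtered family away from `σ`: a common member would be disjoint from
itself. -/
theorem link_disjointFamilies {𝒱 : Finset (Finset S)} (h𝒱 : ∀ I ∈ 𝒱, I.Nonempty)
    {σ : Finset (Finset S)} (hσ : σ ∈ (disjointFamilies 𝒱).faces) :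
    (disjointFamilies 𝒱).link σ =
      disjointFamilies (𝒱.filter fun J => ∀ I ∈ σ, Disjoint I J) := by
  obtain ⟨hne, hσ𝒱, hσd⟩ := hσ
  ext τ
  constructor
  · rintro ⟨hτ, hdisj, -, hsub, hd⟩
    refine ⟨hτ, fun J hJ => Finset.mem_filter.2 ⟨hsub (Finset.mem_union_right _ hJ),
      fun I hI => ?_⟩, fun I hI J hJ => hd I (Finset.mem_union_right _ hI) J
        (Finset.mem_union_right _ hJ)⟩
    exact hd I (Finset.mem_union_left _ hI) J (Finset.mem_union_right _ hJ)
      fun h => Finset.disjoint_left.1 hdisj hI (h ▸ hJ)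
  · rintro ⟨hτ, hsub, hd⟩
    have hsub' : ∀ J ∈ τ, J ∈ 𝒱 ∧ ∀ I ∈ σ, Disjoint I J := fun J hJ =>
      Finset.mem_filter.1 (hsub hJ)
    refine ⟨hτ, Finset.disjoint_left.2 fun I hI hIτ => ?_, hτ.mono Finset.subset_union_right,
      Finset.union_subset hσ𝒱 fun J hJ => (hsub' J hJ).1, fun I hI J hJ hIJ => ?_⟩
    · exact (h𝒱 I (hσ𝒱 hI)).ne_empty (disjoint_self.1 ((hsub' I hIτ).2 I hI))
    · rcases Finset.mem_union.1 hI with hI | hI <;> rcases Finset.mem_union.1 hJ with hJ | hJ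
      · exact hσd I hI J hJ hIJ
      · exact (hsub' J hJ).2 I hI
      · exact ((hsub' I hI).2 J hJ).symm
      · exact hd I hI J hJ hIJ

/-- If a family of nonempty subsets of `U` with at most `c` elements contains all singletons, then
its complex of disjoint subfamilies is an extensor in all dimensions below `#U / c`. -/
theorem isCompactExtensor_disjointFamilies {c : ℕ} (hc : 1 ≤ c) (𝒱 : Finset (Finset S)) :
    ∀ (U : Finset S) (d : ℕ), (∀ s ∈ U, {s} ∈ 𝒱) →
      (∀ I ∈ 𝒱, I ⊆ U ∧ I.Nonempty ∧ I.card ≤ c) → c * (d + 1) ≤ U.card →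
      IsCompactExtensor d (disjointFamilies 𝒱).realization := by
  induction h : 𝒱.card using Nat.strong_induction_on generalizing 𝒱 with
  | _ n ih =>
  subst h
  intro U d hU h𝒱 hd
  have hUne : U.Nonempty := Finset.card_pos.1 (lt_of_lt_of_le (by positivity) hd)
  obtain ⟨s, hs⟩ := hUne
  have hvertex : ∀ I ∈ 𝒱, {I} ∈ (disjointFamilies 𝒱).faces := fun I hI =>
    ⟨Finset.singleton_nonempty _, by simpa using hI, fun J hJ J' hJ' hne =>
      absurd ((Finset.mem_singleton.1 hJ).trans (Finset.mem_singleton.1 hJ').symm) hne⟩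
  by_cases hbig : ∃ I ∈ 𝒱, I.card ≠ 1
  · obtain ⟨I, hI, hI1⟩ := hbig
    obtain ⟨hIU, hIne, hIc⟩ := h𝒱 I hI
    have hdel : IsCompactExtensor d ((disjointFamilies 𝒱).deletion I).realization := by
      rw [deletion_disjointFamilies]
      refine ih _ (Finset.card_erase_lt_of_mem hI) _ rfl U d (fun s hs => ?_)
        (fun J hJ => h𝒱 J (Finset.mem_of_mem_erase hJ)) hd
      exact Finset.mem_erase.2 ⟨fun h => hI1 (h ▸ Finset.card_singleton s), hU s hs⟩
    cases d with
    | zero =>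
      -- There is no lower dimension to use for the link, but `ℝ^0` is a point and any vertex serves
      -- as value off `A`.
      intro Z A hZ hA hAZ f hf hfK
      have hp : (Pi.single {s} 1 : Finset S → ℝ) ∈ (disjointFamilies 𝒱).realization := by
        refine ⟨single_mem_stdSimplex ℝ _, {{s}}, hvertex _ (hU s hs), fun w hw => ?_⟩
        rw [Finset.mem_singleton]
        by_contra h
        exact hw (Pi.single_eq_of_ne h 1)
      classical
      exact ⟨A.piecewise f fun _ => Pi.single {s} 1,
        (Set.subsingleton_of_subsingleton).continuousOn _, fun x _ => by
          by_cases hx : x ∈ A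
          · rw [Set.piecewise_eq_of_mem _ _ _ hx]; exact hfK hx
          · rw [Set.piecewise_eq_of_notMem _ _ _ hx]; exact hp,
        Set.piecewise_eqOn _ _ _⟩
    | succ d =>
      refine isCompactExtensor_of_deletion_of_link (hvertex I hI) hdel ?_
      rw [link_disjointFamilies (fun J hJ => (h𝒱 J hJ).2.1) (hvertex I hI)]
      simp only [Finset.mem_singleton, forall_eq]
      refine ih _ ?_ _ rfl (U \ I) d (fun s hs => ?_) (fun J hJ => ?_) ?_
      · refine Finset.card_lt_card (Finset.filter_ssubset.2 ⟨I, hI, fun h => ?_⟩)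
        exact hIne.ne_empty (disjoint_self.1 h)
      · rw [Finset.mem_sdiff] at hs
        exact Finset.mem_filter.2 ⟨hU s hs.1, Finset.disjoint_singleton_right.2 hs.2⟩
      · obtain ⟨hJ, hIJ⟩ := Finset.mem_filter.1 hJ
        exact ⟨Finset.subset_sdiff.2 ⟨(h𝒱 J hJ).1, hIJ.symm⟩, (h𝒱 J hJ).2⟩
      · rw [Finset.card_sdiff_of_subset hIU]
        apply Nat.le_sub_of_add_le
        calc c * (d + 1) + I.card ≤ c * (d + 1) + c := by gcongr
          _ = c * (d + 1 + 1) := by ring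
          _ ≤ U.card := hd
  · push Not at hbig
    refine isCompactExtensor_of_cone (v := {s}) (hvertex _ (hU s hs)) ?_ d
    rintro σ ⟨hne, hσ, hσd⟩
    have hall : ∀ I ∈ 𝒱, ∀ J ∈ 𝒱, I ≠ J → Disjoint I J := by
      intro I hI J hJ hIJ
      obtain ⟨a, rfl⟩ := Finset.card_eq_one.1 (hbig I hI)
      obtain ⟨b, rfl⟩ := Finset.card_eq_one.1 (hbig J hJ)
      simpa using hIJ
    have hsub : insert {s} σ ⊆ 𝒱 := Finset.insert_subset (hU s hs) hσ
    exact ⟨Finset.insert_nonempty _ _, hsub, fun I hI J hJ => hall I (hsub hI) J (hsub hJ)⟩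

theorem isKConnected_disjointFamilies {c : ℕ} (hc : 1 ≤ c) {𝒱 : Finset (Finset S)} {U : Finset S}
    (hU : ∀ s ∈ U, {s} ∈ 𝒱) (h𝒱 : ∀ I ∈ 𝒱, I ⊆ U ∧ I.Nonempty ∧ I.card ≤ c) {k : ℤ}
    (hk : k + 2 ≤ (U.card / c : ℕ)) : IsKConnected k (disjointFamilies 𝒱).realization := by
  refine isKConnected_of_isCompactExtensor fun d hd =>
    isCompactExtensor_disjointFamilies hc 𝒱 U d hU h𝒱 ?_
  have h : d + 1 ≤ U.card / c := by
    zify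
    push_cast at hk
    linarith
  rw [mul_comm]
  exact (Nat.le_div_iff_mul_le hc).1 h

end disjointFamilies

theorem mainTheorem10 {S : Type*} [Fintype S] [DecidableEq S] (c : ℕ) (hc : 1 ≤ c)
    (f : S → ℕ) (hf : ∀ s, 1 ≤ f s ∧ f s ≤ c) :
    (boundedChargeInj c f).IsWeaklyCohenMacaulay (((Fintype.card S / c : ℕ) : ℤ) - 1) := by
  let 𝒱 : Finset (Finset S) := Finset.univ.filter fun I => I.Nonempty ∧ ∑ i ∈ I, f i ≤ c
  have hmem : ∀ I, I ∈ 𝒱 ↔ I.Nonempty ∧ ∑ i ∈ I, f i ≤ c := fun I => by simp [𝒱]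
  have hK : boundedChargeInj c f = disjointFamilies 𝒱 := by
    ext σ
    refine and_congr_right fun _ => and_congr_left fun _ => ?_
    exact forall₂_congr fun I _ => (hmem I).symm
  have hsing : ∀ s, {s} ∈ 𝒱 := fun s => by simpa [hmem] using (hf s).2
  have hcard : ∀ I ∈ 𝒱, I.card ≤ c := fun I hI =>
    (Finset.card_eq_sum_ones I).le.trans
      ((Finset.sum_le_sum fun i _ => (hf i).1).trans ((hmem I).1 hI).2)
  have h𝒱 : ∀ I ∈ 𝒱, I.Nonempty := fun I hI => ((hmem I).1 hI).1
  rw [hK]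
  constructor
  · refine isKConnected_disjointFamilies hc (U := Finset.univ) (fun s _ => hsing s)
      (fun I hI => ⟨Finset.subset_univ _, h𝒱 I hI, hcard I hI⟩) ?_
    rw [Finset.card_univ]
    linarith
  · intro p σ hσ hσp
    rw [link_disjointFamilies h𝒱 hσ]
    refine isKConnected_disjointFamilies hc (U := Finset.univ \ σ.biUnion id) (fun s hs => ?_)
      (fun J hJ => ?_) ?_
    · rw [Finset.mem_sdiff, Finset.mem_biUnion] at hs
      exact Finset.mem_filter.2 ⟨hsing s, fun I hI =>
        Finset.disjoint_singleton_right.2 fun h => hs.2 ⟨I, hI, h⟩⟩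
    · obtain ⟨hJ, hd⟩ := Finset.mem_filter.1 hJ
      refine ⟨Finset.subset_sdiff.2 ⟨Finset.subset_univ _, ?_⟩, h𝒱 J hJ, hcard J hJ⟩
      exact (Finset.disjoint_biUnion_right _ _ _).2 fun I hI => (hd I hI).symm
    -- The `p + 1` members of `σ` use up at most `(p + 1) * c` points, which lowers the quotient by
    -- `c` by at most `p + 1`.
    · have h1 : (σ.biUnion id).card ≤ (p + 1) * c := hσp ▸
        Finset.card_biUnion_le_card_mul _ _ _ fun I hI => hcard I (hσ.2.1 hI)
      have h2 : Fintype.card S / c - (p + 1) ≤ (Finset.univ \ σ.biUnion id).card / c := by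
        rw [← Nat.sub_mul_div, Finset.card_sdiff_of_subset (Finset.subset_univ _),
          Finset.card_univ]
        exact Nat.div_le_div_right (Nat.sub_le_sub_left (by linarith) _)
      omega
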